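/- Let $$p(z)=a_0z^n+a_1z^{n-1}+\dots+a_n,\qquad a_0,\dots,a_n\in\mathbb R,\quad a_0>0,\ a_n>0,$$ be a real polynomial of degree $n\ge 1$. Its finite Hurwitz matrix is the $n\times n$ matrix $\mathcal H_n(p)=(a_{2j-i})_{i,j=1}^n$, where $a_k=0$ for $k<0$ and for $k>n$. A real matrix is totally nonnegative if all its minors are nonnegative. The polynomial $p$ is quasi-stable if all its zeros lie in the closed left half-plane $\operatorname{Re} z\le 0$. We say that $p$ has the reflection property if, whenever $p(\lambda)=0$ for some $\lambda\in\mathbb C$ with $\operatorname{Re}\lambda>0$, then $-\lambda$ is also a zero of $p$, of at least the same multiplicity as $\lambda$. Arguments are taken in $(-\pi,\pi]$. (a) Let $n\ge 4$. If $p$ has no zeros in the sector $$|\arg z|<\frac{\pi}{2}\cdot\frac{n-2}{n-1}$$ and has the reflection property, then $\mathcal H_n(p)$ is totally nonnegative. (b) The angle in (a) is sharp: for every $n\ge 4$ and every real $\alpha<\frac{\pi}{2}\cdot\frac{n-2}{n-1}$ there is a polynomial $p$ of degree $n$ as above that has no zeros in the sector $|\arg z|<\alpha$, has the reflection property, and whose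 matrix $\mathcal H_n(p)$ is not totally nonnegative. (c) If $1\le n\le 3$, then $p$ is quasi-stable if and only if $\mathcal H_n(p)$ is totally nonnegative. -/

import Mathlib

open Polynomial

/-- A real matrix is totally nonnegative if all its minors (of every order, formed with arbitrary
increasing sequences of rows and of columns) are nonnegative. -/
def TotallyNonneg {m n : ℕ} (A : Matrix (Fin m) (Fin n) ℝ) : Prop :=
  ∀ (k : ℕ) (r : Fin k → Fin m) (c : Fin k → Fin n), StrictMono r → StrictMono c →
    0 ≤ (A.submatrix r c).det

/-- The coefficient `a_k` of `p(z) = a_0 z^n + a_1 z^(n-1) + ⋯ + a_n`, with the convention that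
`a_k = 0` for `k < 0` and for `k > n`. -/
noncomputable def descCoeff (n : ℕ) (p : ℝ[X]) (k : ℤ) : ℝ :=
  if 0 ≤ k ∧ k ≤ n then p.coeff (n - k).toNat else 0

/-- The finite Hurwitz matrix of a polynomial `p` of degree `n`: its entry in row `i` and column `j`
is `a_(2j-i)`, where `i, j = 1, …, n` (the indices `i j : Fin n` below start at `0`). -/
noncomputable def hurwitzMatrix (n : ℕ) (p : ℝ[X]) : Matrix (Fin n) (Fin n) ℝ :=
  Matrix.of fun i j => descCoeff n p (2 * ((j : ℤ) + 1) - ((i : ℤ) + 1))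

/-- `p` is a real polynomial `a_0 z^n + ⋯ + a_n` of degree `n` with `a_0 > 0` and `a_n > 0`. -/
def IsAdmissible (n : ℕ) (p : ℝ[X]) : Prop :=
  p.natDegree = n ∧ 0 < p.leadingCoeff ∧ 0 < p.coeff 0

/-- All complex zeros of `p` lie in the closed left half-plane. -/
def IsQuasiStable (p : ℝ[X]) : Prop :=
  ∀ z : ℂ, aeval z p = 0 → z.re ≤ 0

/-- `p` has no complex zeros in the open sector `|arg z| < α`. -/
def NoZerosInSector (α : ℝ) (p : ℝ[X]) : Prop :=
  ∀ z : ℂ, aeval z p = 0 → ¬ |z.arg| < α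

/-- The reflection property, zeros being counted with multiplicity: whenever `w` is a zero of `p`
with `Re w > 0`, then `-w` is a zero of `p` of at least the same multiplicity. -/
def ReflectionProperty (p : ℝ[X]) : Prop :=
  ∀ w : ℂ, aeval w p = 0 → 0 < w.re →
    (p.map (algebraMap ℝ ℂ)).rootMultiplicity w ≤ (p.map (algebraMap ℝ ℂ)).rootMultiplicity (-w)

/-! Multiplying `p` by an even polynomial `Q(z²)` multiplies its Hurwitz matrix on the right by the
banded Toeplitz matrix of `Q`, so even factors can be split off one at a time. By the reflection
property a nonreal zero `w` with `Re w > 0` lies in a quadruple `±w, ±w̄`, which contributes `z⁴ +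
2ρ cos φ z² + ρ²` with `ρ = |w|²` and `φ = π - 2|arg w|`; the sector condition says exactly `(n -
1)φ ≤ π`. The full Toeplitz matrix of `u² + 2ρ cos φ u + ρ²` need not be totally nonnegative, but
the finite Hurwitz matrix sees only a window of it, and there it factors into two nonnegative
bidiagonal matrices whose entries are ratios of sines (`KernelTN.quadratic`). A pair of imaginary
zeros gives one nonnegative bidiagonal factor. The remaining cofactor is stable, and Routh's
algorithm factors its Hurwitz matrix (`IsStable.kernelTN`).

For sharpness take `(z⁴ + 2 cos φ z² + 1)(z + 1)^(n-4)` with `π/(n-1) < φ < π/(n-2)`. One of its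
minors is a positive minor belonging to `(z + 1)^(n-4)` times `sin((n-1)φ) / sin φ < 0`. In degree
at most 3 the converse follows by eliminating the imaginary part of a supposed zero. -/

/-! ### Operations preserving total nonnegativity. -/

/-- All minors of a doubly infinite matrix are nonnegative. -/
def KernelTN (K : ℤ → ℤ → ℝ) : Prop :=
  ∀ (k : ℕ) (r c : Fin k → ℤ), StrictMono r → StrictMono c →
    0 ≤ (Matrix.of fun i j => K (r i) (c j)).det

theorem KernelTN.transpose {K : ℤ → ℤ → ℝ} (h : KernelTN K) : KernelTN fun i j => K j i := by
  intro k r c hr hc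
  have := h k c r hc hr
  rw [← Matrix.det_transpose] at this
  exact this

/-- Expand a minor multilinearly in its rows. Moving some of the strictly increasing row indices up
by one leaves them strictly increasing or makes two of them equal, and in the latter case the
determinant vanishes. -/
theorem KernelTN.rows {K : ℤ → ℤ → ℝ} (h : KernelTN K) {α β : ℤ → ℝ} (hα : ∀ i, 0 ≤ α i)
    (hβ : ∀ i, 0 ≤ β i) : KernelTN fun i j => α i * K i j + β i * K (i + 1) j := by
  intro k r c hr hc
  have key : (Matrix.of fun i j => α (r i) * K (r i) (c j) + β (r i) * K (r i + 1) (c j)).det =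
      ∑ s : Finset (Fin k), (∏ i, if i ∈ s then α (r i) else β (r i)) *
        (Matrix.of fun i j => K (if i ∈ s then r i else r i + 1) (c j)).det := by
    have := (Matrix.detRowAlternating (n := Fin k) (R := ℝ)).toMultilinearMap.map_add_univ
      (fun i j => α (r i) * K (r i) (c j)) (fun i j => β (r i) * K (r i + 1) (c j))
    refine this.trans (Finset.sum_congr rfl fun s _ => ?_)
    have h2 := (Matrix.detRowAlternating (n := Fin k) (R := ℝ)).toMultilinearMap.map_smul_univ
      (fun i => if i ∈ s then α (r i) else β (r i))
      (fun i j => K (if i ∈ s then r i else r i + 1) (c j))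
    refine Eq.trans ?_ h2
    congr 1
    ext i j
    by_cases hi : i ∈ s <;> simp [Finset.piecewise, hi]
  rw [key]
  refine Finset.sum_nonneg fun s _ => mul_nonneg (Finset.prod_nonneg fun i _ => ?_) ?_
  · split_ifs
    exacts [hα _, hβ _]
  · by_cases hs : StrictMono fun i => if i ∈ s then r i else r i + 1
    · exact h k _ c hs hc
    · simp only [StrictMono, not_forall] at hs
      obtain ⟨i, j, hij, hlt⟩ := hs
      refine le_of_eq (Matrix.det_zero_of_row_eq hij.ne ?_).symm
      have h1 := hr hij
      have : (if i ∈ s then r i else r i + 1) = if j ∈ s then r j else r j + 1 := by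
        split_ifs at hlt ⊢ <;> omega
      ext t
      simp [this]

theorem KernelTN.columns {K : ℤ → ℤ → ℝ} (h : KernelTN K) {x : ℤ → ℝ} (hx : ∀ j, 0 ≤ x j) :
    KernelTN fun i j => K i j + x j * K i (j - 1) := by
  have h1 : KernelTN fun i j => K j (i - 1) := fun k r c hr hc =>
    h.transpose k (fun i => r i - 1) c (fun a b hab => sub_lt_sub_right (hr hab) 1) hc
  have h2 := (h1.rows (α := x) (β := fun _ => 1) hx fun _ => zero_le_one).transpose
  convert h2 using 3
  simp [add_comm]

theorem KernelTN.truncate {K : ℤ → ℤ → ℝ} (h : KernelTN K) (P : ℤ → Prop) [DecidablePred P] :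
    KernelTN fun i j => if P i then K i j else 0 := by
  intro k r c hr hc
  by_cases hP : ∀ i, P (r i)
  · simpa [hP] using h k r c hr hc
  · push Not at hP
    obtain ⟨i, hi⟩ := hP
    rw [Matrix.det_eq_zero_of_row_eq_zero i fun j => by simp [hi]]

theorem kernelTN_double_index {a : ℝ} (ha : 0 ≤ a) :
    KernelTN fun i j => if 2 * j = i then a else 0 := by
  intro k r c hr hc
  by_cases h : ∀ i, ∃ j, 2 * c j = r i
  · choose f hf using h
    have hmono : StrictMono f := by
      intro i j hij
      have := hr hij
      rw [← hf i, ← hf j] at this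
      exact hc.lt_iff_lt.1 (by linarith)
    -- A strictly increasing self-map of a finite chain is the identity, so a minor without zero
    -- rows is diagonal.
    have hid : ∀ i, f i = i := fun i => by
      have : (OrderEmbedding.ofStrictMono f hmono).toOrderHom i = i := by
        have h1 := hmono.id_le i
        have h2 := hmono.le_id i
        exact le_antisymm h2 h1
      exact this
    have hrc : ∀ i, r i = 2 * c i := fun i => by rw [← hf i, hid i]
    have hm : (Matrix.of fun i j => if 2 * c j = r i then a else 0) =
        Matrix.diagonal fun _ : Fin k => a := by
      ext i j
      rw [Matrix.of_apply, Matrix.diagonal_apply, hrc]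
      congr 1
      simp [hc.injective.eq_iff, eq_comm]
    rw [hm, Matrix.det_diagonal]
    exact Finset.prod_nonneg fun _ _ => ha
  · push Not at h
    obtain ⟨i, hi⟩ := h
    rw [Matrix.det_eq_zero_of_row_eq_zero i fun j => by simp [hi j]]

theorem KernelTN.of_tendsto {ι : Type*} {l : Filter ι} [l.NeBot] {F : ι → ℤ → ℤ → ℝ}
    {K : ℤ → ℤ → ℝ} (hF : ∀ᶠ t in l, KernelTN (F t))
    (h : ∀ i j, Filter.Tendsto (fun t => F t i j) l (nhds (K i j))) : KernelTN K := by
  intro k r c hr hc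
  have : Filter.Tendsto (fun t => (Matrix.of fun i j => F t (r i) (c j)).det) l
      (nhds (Matrix.of fun i j => K (r i) (c j)).det) := by
    simp only [Matrix.det_apply, Matrix.of_apply]
    exact tendsto_finsetSum _ fun σ _ => (tendsto_finsetProd _ fun i _ => h _ _).const_smul _
  exact ge_of_tendsto this (hF.mono fun t ht => ht k r c hr hc)

-- On the columns `1, …, r` carrying `K`, the three-term operator is the composite of two bidiagonal
-- ones with weights `x j = ρ sin(jφ)/sin((j-1)φ)` and `y j = ρ sin((j-2)φ)/sin((j-1)φ)`: their sum
-- is `2ρ cos φ` and `y j * x (j-1) = ρ²`. The bound on `(r + 1)φ` makes all these sines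
-- nonnegative.
open Real in
theorem KernelTN.quadratic_of_lt {K : ℤ → ℤ → ℝ} (h : KernelTN K) {r : ℤ}
    (h0 : ∀ i j, j ≤ 0 → K i j = 0) (hr : ∀ i j, r < j → K i j = 0) {ρ φ : ℝ} (hρ : 0 ≤ ρ)
    (hφ : 0 < φ) (hrφ : (r + 1) * φ < π) :
    KernelTN fun i j => K i j + 2 * ρ * cos φ * K i (j - 1) + ρ ^ 2 * K i (j - 2) := by
  have hsin : ∀ j : ℤ, 1 ≤ j → j ≤ r + 1 → 0 < sin (j * φ) := fun j h1 h2 => by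
    have h1' : (1 : ℝ) ≤ j := by exact_mod_cast h1
    have h2' : (j : ℝ) ≤ r + 1 := by exact_mod_cast h2
    exact sin_pos_of_pos_of_lt_pi (by positivity) (by nlinarith)
  have hsin' : ∀ j : ℤ, 0 ≤ j → j ≤ r + 1 → 0 ≤ sin (j * φ) := fun j h1 h2 => by
    rcases h1.eq_or_lt with rfl | h1
    · simp
    · exact (hsin j h1 h2).le
  let x : ℤ → ℝ := fun j =>
    if 1 ≤ j - 1 ∧ j - 1 ≤ r then ρ * (sin ((j : ℤ) * φ) / sin ((j - 1 : ℤ) * φ)) else 0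
  -- The range is one longer than for `x`, since `y j` also multiplies `x (j - 1) * K i (j - 2)`.
  let y : ℤ → ℝ := fun j =>
    if 1 ≤ j - 1 ∧ j - 1 ≤ r + 1 then ρ * (sin ((j - 2 : ℤ) * φ) / sin ((j - 1 : ℤ) * φ)) else 0
  have hx : ∀ j, 0 ≤ x j := fun j => by
    dsimp only [x]
    split_ifs with hj
    · exact mul_nonneg hρ
        (div_nonneg (hsin' _ (by omega) (by omega)) (hsin' _ (by omega) (by omega)))
    · exact le_rfl
  have hy : ∀ j, 0 ≤ y j := fun j => by
    dsimp only [y]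
    split_ifs with hj
    · exact mul_nonneg hρ
        (div_nonneg (hsin' _ (by omega) (by omega)) (hsin' _ (by omega) (by omega)))
    · exact le_rfl
  convert (h.columns hx).columns hy using 3 with i j
  have e1 : 2 * ρ * cos φ * K i (j - 1) = (x j + y j) * K i (j - 1) := by
    by_cases hj : 1 ≤ j - 1 ∧ j - 1 ≤ r
    · congr 1
      have hs := hsin (j - 1) hj.1 (by omega)
      have hadd : sin ((j : ℤ) * φ) + sin ((j - 2 : ℤ) * φ) =
          2 * cos φ * sin ((j - 1 : ℤ) * φ) := by
        have e1 : ((j : ℤ) : ℝ) * φ = ((j - 1 : ℤ) : ℝ) * φ + φ := by push_cast; ring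
        have e2 : ((j - 2 : ℤ) : ℝ) * φ = ((j - 1 : ℤ) : ℝ) * φ - φ := by push_cast; ring
        rw [e1, e2, sin_add, sin_sub]
        ring
      simp only [x, y]
      rw [if_pos hj, if_pos ⟨hj.1, by omega⟩, ← mul_add, ← add_div, hadd]
      field_simp
    · have : K i (j - 1) = 0 := by
        by_cases hj1 : 1 ≤ j - 1
        · exact hr _ _ (by omega)
        · exact h0 _ _ (by omega)
      rw [this]
      ring
  have e2 : ρ ^ 2 * K i (j - 2) = y j * x (j - 1) * K i (j - 2) := by
    by_cases hj : 1 ≤ j - 2 ∧ j - 2 ≤ r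
    · congr 1
      have hs := hsin (j - 1) (by omega) (by omega)
      have hs2 := hsin (j - 2) hj.1 (by omega)
      simp only [x, y]
      rw [if_pos ⟨by omega, by omega⟩, if_pos ⟨by omega, by omega⟩,
        show j - 1 - 1 = j - 2 by ring]
      generalize sin ((j - 1 : ℤ) * φ) = a at hs ⊢
      generalize sin ((j - 2 : ℤ) * φ) = b at hs2 ⊢
      field_simp
    · have : K i (j - 2) = 0 := by
        by_cases hj1 : 1 ≤ j - 2
        · exact hr _ _ (by omega)
        · exact h0 _ _ (by omega)
      rw [this]
      ring
  rw [e1, e2, show j - 1 - 1 = j - 2 by ring]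
  ring

-- The boundary case `(r + 1)φ = π` is reached by letting the angle increase to `φ`.
open Real in
theorem KernelTN.quadratic {K : ℤ → ℤ → ℝ} (h : KernelTN K) {r : ℤ} (hr0 : 0 ≤ r)
    (h0 : ∀ i j, j ≤ 0 → K i j = 0) (hr : ∀ i j, r < j → K i j = 0) {ρ φ : ℝ} (hρ : 0 ≤ ρ)
    (hφ : 0 < φ) (hrφ : (r + 1) * φ ≤ π) :
    KernelTN fun i j => K i j + 2 * ρ * cos φ * K i (j - 1) + ρ ^ 2 * K i (j - 2) := by
  have hr1 : (0 : ℝ) < r + 1 := by exact_mod_cast (by omega : 0 < r + 1)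
  refine KernelTN.of_tendsto (l := nhdsWithin φ (Set.Iio φ))
    (F := fun t i j => K i j + 2 * ρ * cos t * K i (j - 1) + ρ ^ 2 * K i (j - 2)) ?_ fun i j => ?_
  · filter_upwards [Ioo_mem_nhdsLT hφ] with t ht
    exact h.quadratic_of_lt h0 hr hρ ht.1 ((mul_lt_mul_of_pos_left ht.2 hr1).trans_le hrφ)
  · refine Filter.Tendsto.mono_left ?_ nhdsWithin_le_nhds
    exact Continuous.tendsto (by fun_prop) φ

/-! ### Coefficients in descending order. -/

theorem descCoeff_of_neg {n : ℕ} {p : ℝ[X]} {k : ℤ} (hk : k < 0) : descCoeff n p k = 0 :=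
  if_neg (by omega)

theorem descCoeff_of_lt {n : ℕ} {p : ℝ[X]} {k : ℤ} (hk : n < k) : descCoeff n p k = 0 :=
  if_neg (by omega)

theorem descCoeff_add (n : ℕ) (p q : ℝ[X]) (k : ℤ) :
    descCoeff n (p + q) k = descCoeff n p k + descCoeff n q k := by
  unfold descCoeff
  split_ifs <;> simp

theorem descCoeff_sub (n : ℕ) (p q : ℝ[X]) (k : ℤ) :
    descCoeff n (p - q) k = descCoeff n p k - descCoeff n q k := by
  unfold descCoeff
  split_ifs <;> simp

theorem descCoeff_C_mul (n : ℕ) (a : ℝ) (p : ℝ[X]) (k : ℤ) :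
    descCoeff n (C a * p) k = a * descCoeff n p k := by
  unfold descCoeff
  split_ifs <;> simp

theorem descCoeff_succ {n : ℕ} {p : ℝ[X]} (hp : p.natDegree ≤ n) (k : ℤ) :
    descCoeff (n + 1) p k = descCoeff n p (k - 1) := by
  by_cases hk : k = 0
  · subst hk
    rw [descCoeff_of_neg (k := 0 - 1) (by norm_num), descCoeff, if_pos (by omega)]
    exact coeff_eq_zero_of_natDegree_lt (by omega)
  · unfold descCoeff
    by_cases h : 0 ≤ k ∧ k ≤ (n + 1 : ℕ)
    · rw [if_pos h, if_pos (by omega)]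
      congr 1
      omega
    · rw [if_neg h, if_neg (by omega)]

theorem descCoeff_X_mul (n : ℕ) (p : ℝ[X]) (k : ℤ) :
    descCoeff (n + 1) (X * p) k = descCoeff n p k := by
  unfold descCoeff
  by_cases hk : k = n + 1
  · subst hk
    rw [if_neg (c := 0 ≤ (n : ℤ) + 1 ∧ (n : ℤ) + 1 ≤ n) (by omega), if_pos (by omega)]
    rw [show (((n + 1 : ℕ) : ℤ) - ((n : ℤ) + 1)).toNat = 0 by omega]
    simp
  · by_cases h : 0 ≤ k ∧ k ≤ n
    · rw [if_pos h, if_pos (by omega),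
        show (((n + 1 : ℕ) : ℤ) - k).toNat = ((n : ℤ) - k).toNat + 1 by omega, coeff_X_mul]
    · rw [if_neg h, if_neg (by omega)]

theorem descCoeff_add_two {n : ℕ} {p : ℝ[X]} (hp : p.natDegree ≤ n) (k : ℤ) :
    descCoeff (n + 2) p k = descCoeff n p (k - 2) := by
  rw [descCoeff_succ (n := n + 1) (by omega), descCoeff_succ hp]
  congr 1
  ring

theorem descCoeff_X_sq_mul (n : ℕ) (p : ℝ[X]) (k : ℤ) :
    descCoeff (n + 2) (X ^ 2 * p) k = descCoeff n p k := by
  rw [pow_two, mul_assoc, descCoeff_X_mul (n + 1), descCoeff_X_mul]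

theorem descCoeff_X_sq_add_C_mul {n : ℕ} {p : ℝ[X]} (hp : p.natDegree ≤ n) (a : ℝ) (k : ℤ) :
    descCoeff (n + 2) ((X ^ 2 + C a) * p) k = descCoeff n p k + a * descCoeff n p (k - 2) := by
  rw [add_mul, descCoeff_add, descCoeff_X_sq_mul, descCoeff_C_mul, descCoeff_add_two hp]

theorem descCoeff_biquadratic_mul {n : ℕ} {p : ℝ[X]} (hp : p.natDegree ≤ n) (b c : ℝ) (k : ℤ) :
    descCoeff (n + 4) ((X ^ 4 + C b * X ^ 2 + C c) * p) k =
      descCoeff n p k + b * descCoeff n p (k - 2) + c * descCoeff n p (k - 4) := by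
  have hX : (X ^ 2 * p).natDegree ≤ n + 2 :=
    natDegree_mul_le.trans (by rw [natDegree_X_pow]; omega)
  rw [show (X ^ 4 + C b * X ^ 2 + C c) * p = X ^ 2 * (X ^ 2 * p) + C b * (X ^ 2 * p) + C c * p by
    ring, descCoeff_add, descCoeff_add, descCoeff_C_mul, descCoeff_C_mul,
    descCoeff_X_sq_mul (n + 2), descCoeff_X_sq_mul, descCoeff_add_two hX, descCoeff_X_sq_mul,
    descCoeff_add_two (n := n + 2) (by omega), descCoeff_add_two hp]
  congr 3
  ring

/-! ### Stable polynomials: Routh's algorithm. -/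

/-- The doubly infinite Hurwitz matrix of a polynomial of degree `n`. -/
noncomputable def hurwitzKernel (n : ℕ) (p : ℝ[X]) (i j : ℤ) : ℝ :=
  descCoeff n p (2 * j - i)

/-- All complex zeros of `p` lie in the open left half-plane. -/
def IsStable (p : ℝ[X]) : Prop :=
  ∀ z : ℂ, aeval z p = 0 → z.re < 0

open Complex in
theorem normSq_prod_sub_normSq_prod_ge (s : Multiset ℂ) (hs : ∀ w ∈ s, w.re < 0) {z : ℂ}
    (hz : 0 ≤ z.re) :
    0 ≤ -(s.map re).sum ∧ (s ≠ 0 → 0 < -(s.map re).sum) ∧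
    2 * z.re * normSq ((s.map fun w => z - w).prod - (s.map fun w => z + (starRingEnd ℂ) w).prod) ≤
      2 * -(s.map re).sum * (normSq (s.map fun w => z - w).prod -
        normSq (s.map fun w => z + (starRingEnd ℂ) w).prod) := by
  induction s using Multiset.induction_on with
  | empty => simp
  | cons w s ih =>
    obtain ⟨hd0, hd, ih⟩ := ih fun v hv => hs v (Multiset.mem_cons_of_mem hv)
    have hw : 0 < -w.re := by linarith [hs w (Multiset.mem_cons_self w s)]
    simp only [Multiset.map_cons, Multiset.prod_cons, Multiset.sum_cons]
    rcases s.empty_or_exists_mem with rfl | ⟨v, hv⟩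
    · refine ⟨by simpa using hw.le, fun _ => by simpa using hw, ?_⟩
      simp [normSq_apply]
      nlinarith
    · have hd := hd fun h => by simp [h] at hv
      refine ⟨by linarith, fun _ => by linarith, ?_⟩
      generalize (s.map fun w => z - w).prod = A at ih ⊢
      generalize (s.map fun w => z + (starRingEnd ℂ) w).prod = B at ih ⊢
      rw [neg_add_rev]
      generalize -(s.map re).sum = d at ih hd ⊢
      refine le_of_mul_le_mul_left (sub_nonneg.1 ?_) hd
      -- This expression equals `d` times the slack of the new inequality: a positive multiple of
      -- the inductive slack plus a square. Cancelling `d` requires `s` nonempty, hence the separate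
      -- case above.
      have key : 0 ≤ (d + -w.re) * normSq (z + (starRingEnd ℂ) w) *
          (2 * d * (normSq A - normSq B) - 2 * z.re * normSq (A - B)) +
          2 * z.re * -w.re * normSq ((z + (starRingEnd ℂ) w) * (A - B) - 2 * d * A) :=
        add_nonneg (mul_nonneg (mul_nonneg (by linarith) (normSq_nonneg _)) (by linarith))
          (mul_nonneg (mul_nonneg (by linarith) hw.le) (normSq_nonneg _))
      refine key.trans_eq ?_
      simp [normSq_apply]
      ring

open Complex in
/-- The quantitative form of the stability of `p`, with `f₁ = (p(z) - (-1)ⁿ p(-z)) / 2`. -/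
theorem IsStable.two_mul_re_mul_normSq_le {p : ℝ[X]} (hp : IsStable p)
    (hlc : 0 < p.leadingCoeff) (hn : 0 < p.natDegree) {z : ℂ} (hz : 0 ≤ z.re) :
    0 < p.nextCoeff ∧ z.re * p.leadingCoeff *
      normSq (aeval z p - (-1) ^ p.natDegree * aeval (-z) p) ≤
      p.nextCoeff * (normSq (aeval z p) - normSq (aeval (-z) p)) := by
  have hp0 : p ≠ 0 := by
    rintro rfl
    simp at hlc
  have hinj : Function.Injective (algebraMap ℝ ℂ) := (algebraMap ℝ ℂ).injective
  have hspl : (p.map (algebraMap ℝ ℂ)).Splits := IsAlgClosed.splits _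
  have hroots : ∀ w ∈ (p.map (algebraMap ℝ ℂ)).roots, w.re < 0 := fun w hw => by
    apply hp
    rw [mem_roots'] at hw
    rw [aeval_def, ← eval_map]
    exact hw.2
  have hcard : (p.map (algebraMap ℝ ℂ)).roots.card = p.natDegree := by
    rw [← hspl.natDegree_eq_card_roots, natDegree_map]
  have hev : ∀ z : ℂ, aeval z p = p.leadingCoeff *
      ((p.map (algebraMap ℝ ℂ)).roots.map fun w => z - w).prod := fun z => by
    rw [aeval_def, ← eval_map, hspl.eval_eq_prod_roots, leadingCoeff_map]
    rfl
  have hconj : ∀ z : ℂ, aeval ((starRingEnd ℂ) z) p = (starRingEnd ℂ) (aeval z p) := fun z =>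
    aeval_conj p z
  -- Since `p` is real, `p(-z)` is the conjugate of `p(-z̄)`, which turns each factor into `z + w̄`
  -- up to sign.
  have hev' : (-1) ^ p.natDegree * aeval (-z) p = p.leadingCoeff *
      ((p.map (algebraMap ℝ ℂ)).roots.map fun w => z + (starRingEnd ℂ) w).prod := by
    have h1 : aeval (-z) p = (starRingEnd ℂ) (aeval ((starRingEnd ℂ) (-z)) p) := by
      rw [← hconj, conj_conj]
    rw [h1, hev, map_mul, conj_ofReal, map_multiset_prod, Multiset.map_map, mul_left_comm, ← hcard,
      ← Multiset.card_map, ← Multiset.prod_map_neg, Multiset.map_map]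
    congr 2
    refine Multiset.map_congr rfl fun w _ => ?_
    simp [add_comm]
  have hsum : p.nextCoeff =
      p.leadingCoeff * -((p.map (algebraMap ℝ ℂ)).roots.map re).sum := by
    have h := hspl.nextCoeff_eq_neg_sum_roots_mul_leadingCoeff
    rw [nextCoeff_map hinj, leadingCoeff_map] at h
    have h2 := congrArg re h
    simp only [coe_algebraMap, ofReal_re, ← ofReal_neg, re_ofReal_mul] at h2
    rw [h2, show (p.map (algebraMap ℝ ℂ)).roots.sum.re =
      ((p.map (algebraMap ℝ ℂ)).roots.map re).sum from map_multiset_sum reAddGroupHom _]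
    ring
  obtain ⟨-, h2, h3⟩ := normSq_prod_sub_normSq_prod_ge _ hroots hz
  have hne : (p.map (algebraMap ℝ ℂ)).roots ≠ 0 := by
    rw [← Multiset.card_pos, hcard]
    exact hn
  refine ⟨hsum ▸ mul_pos hlc (h2 hne), ?_⟩
  have hB : normSq (aeval (-z) p) = normSq ((-1) ^ p.natDegree * aeval (-z) p) := by
    rw [normSq_mul, map_pow]
    simp
  rw [hB, hev', hev, hsum, ← mul_sub]
  simp only [normSq_mul, normSq_ofReal]
  have := mul_le_mul_of_nonneg_left h3 (by positivity : 0 ≤ p.leadingCoeff ^ 3 / 2)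
  linarith

/-- The polynomial obtained from `p` by one step of Routh's algorithm. -/
noncomputable def routhStep (p : ℝ[X]) : ℝ[X] :=
  p - C (p.leadingCoeff / (2 * p.nextCoeff)) *
    (X * (p - C ((-1) ^ p.natDegree) * p.comp (-X)))

theorem coeff_comp_neg_X {R : Type*} [CommRing R] (p : R[X]) (k : ℕ) :
    (p.comp (-X)).coeff k = (-1) ^ k * p.coeff k := by
  rw [← neg_one_mul (X : R[X]), ← C_1, ← C_neg, comp_C_mul_X_coeff, mul_comm]

theorem descCoeff_comp_neg_X {n : ℕ} (p : ℝ[X]) (k : ℤ) :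
    (-1) ^ n * descCoeff n (p.comp (-X)) k = if Even k then descCoeff n p k else -descCoeff n p k := by
  unfold descCoeff
  split_ifs with h1 h2 h2
  · rw [coeff_comp_neg_X, ← mul_assoc, ← pow_add, Even.neg_one_pow, one_mul]
    have := Int.even_iff.1 h2
    rw [Nat.even_iff]
    omega
  · rw [coeff_comp_neg_X, ← mul_assoc, ← pow_add, Odd.neg_one_pow, neg_one_mul]
    rw [Int.not_even_iff] at h2
    rw [Nat.odd_iff]
    omega
  · simp
  · simp

theorem descCoeff_zero (p : ℝ[X]) : descCoeff p.natDegree p 0 = p.leadingCoeff := by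
  simp [descCoeff]

theorem descCoeff_one {p : ℝ[X]} (hp : 0 < p.natDegree) :
    descCoeff p.natDegree p 1 = p.nextCoeff := by
  rw [nextCoeff_of_natDegree_pos hp, descCoeff, if_pos (by omega)]
  congr 1
  omega

theorem natDegree_comp_neg_X (p : ℝ[X]) : (p.comp (-X)).natDegree = p.natDegree := by
  rw [natDegree_comp, natDegree_neg, natDegree_X, mul_one]

theorem descCoeff_sub_comp_neg_X {n : ℕ} {p : ℝ[X]} (hp : p.natDegree = n) (k : ℤ) :
    descCoeff n (p - C ((-1) ^ p.natDegree) * p.comp (-X)) k =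
      if Even k then 0 else 2 * descCoeff n p k := by
  rw [descCoeff_sub, descCoeff_C_mul, hp, descCoeff_comp_neg_X]
  split_ifs <;> ring

theorem natDegree_sub_comp_neg_X_le {n : ℕ} {p : ℝ[X]} (hp : p.natDegree = n + 1) :
    (p - C ((-1) ^ p.natDegree) * p.comp (-X)).natDegree ≤ n := by
  rw [natDegree_le_iff_coeff_eq_zero]
  intro N hN
  rcases (show n + 1 ≤ N by omega).eq_or_lt with rfl | h
  · have := descCoeff_sub_comp_neg_X hp 0
    rwa [if_pos Even.zero, descCoeff, if_pos (by omega),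
      show (((n + 1 : ℕ) : ℤ) - 0).toNat = n + 1 by omega] at this
  · refine coeff_eq_zero_of_natDegree_lt (lt_of_le_of_lt ?_ h)
    refine (natDegree_sub_le _ _).trans (max_le hp.le ((natDegree_C_mul_le _ _).trans ?_))
    rw [natDegree_comp_neg_X, hp]

theorem descCoeff_routhStep {n : ℕ} {p : ℝ[X]} (hp : p.natDegree = n + 1) (k : ℤ) :
    descCoeff (n + 1) (routhStep p) k = descCoeff (n + 1) p k -
      p.leadingCoeff / p.nextCoeff * if Even k then descCoeff (n + 1) p (k + 1) else 0 := by
  have h := descCoeff_sub_comp_neg_X hp (k + 1)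
  rw [descCoeff_succ (natDegree_sub_comp_neg_X_le hp), add_sub_cancel_right] at h
  rw [routhStep, descCoeff_sub, descCoeff_C_mul, descCoeff_X_mul, h]
  by_cases hk : Even k
  · rw [if_pos hk, if_neg (by simpa [Int.even_add_one] using hk)]
    field_simp
  · rw [if_neg hk, if_pos (by simpa [Int.even_add_one] using hk)]
    simp

theorem natDegree_routhStep_le {n : ℕ} {p : ℝ[X]} (hp : p.natDegree = n + 1)
    (hp1 : p.nextCoeff ≠ 0) : (routhStep p).natDegree ≤ n := by
  rw [natDegree_le_iff_coeff_eq_zero]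
  intro N hN
  rcases (show n + 1 ≤ N by omega).eq_or_lt with rfl | h
  · have h := descCoeff_routhStep hp 0
    have h1 := descCoeff_zero p
    have h2 := descCoeff_one (p := p) (by omega)
    rw [hp] at h1 h2
    rw [h1, if_pos Even.zero, zero_add, h2, div_mul_cancel₀ _ hp1, sub_self] at h
    rwa [descCoeff, if_pos (by omega),
      show (((n + 1 : ℕ) : ℤ) - 0).toNat = n + 1 by omega] at h
  · refine coeff_eq_zero_of_natDegree_lt (lt_of_le_of_lt ?_ h)
    unfold routhStep
    refine (natDegree_sub_le _ _).trans (max_le hp.le ((natDegree_C_mul_le _ _).trans ?_))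
    refine natDegree_mul_le.trans ?_
    rw [natDegree_X]
    have := natDegree_sub_comp_neg_X_le hp
    omega

/-- Inverts a Routh step. With `k = 2j - i` it reads: row `i` of the Hurwitz matrix of `p` is row `i
+ 1` of that of `routhStep p`, plus, for even `i`, a positive multiple of row `i` when `p` is
stable. -/
theorem descCoeff_eq_routhStep {n : ℕ} {p : ℝ[X]} (hp : p.natDegree = n + 1)
    (hp1 : p.nextCoeff ≠ 0) (k : ℤ) :
    descCoeff (n + 1) p k = (if Even k then p.leadingCoeff / p.nextCoeff else 0) *
      descCoeff n (routhStep p) k + descCoeff n (routhStep p) (k - 1) := by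
  have hd := natDegree_routhStep_le hp hp1
  have h1 := descCoeff_routhStep hp k
  have h2 := descCoeff_routhStep hp (k + 1)
  rw [descCoeff_succ hd] at h1 h2
  rw [add_sub_cancel_right] at h2
  rw [h1, h2]
  by_cases hk : Even k
  · rw [if_pos hk, if_pos hk, if_neg (by simpa [Int.even_add_one] using hk)]
    ring
  · rw [if_neg hk, if_neg hk]
    ring

open Complex in
theorem isStable_routhStep {p : ℝ[X]} (hp : IsStable p) (hlc : 0 < p.leadingCoeff)
    (hn : 0 < p.natDegree) : IsStable (routhStep p) := by
  intro z hz
  by_contra hre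
  rw [not_lt] at hre
  obtain ⟨h1, h2⟩ := hp.two_mul_re_mul_normSq_le hlc hn hre
  have hc : aeval z (routhStep p) = aeval z p -
      ((p.leadingCoeff / (2 * p.nextCoeff) : ℝ) : ℂ) *
        (z * (aeval z p - (-1) ^ p.natDegree * aeval (-z) p)) := by
    simp only [routhStep, map_sub, map_mul, aeval_X, aeval_comp, map_neg, aeval_C, map_pow,
      map_one]
    rfl
  rw [hc, sub_eq_zero] at hz
  have hB : normSq (aeval (-z) p) = normSq ((-1) ^ p.natDegree * aeval (-z) p) := by
    rw [normSq_mul, map_pow]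
    simp
  have hpz : aeval z p ≠ 0 := fun h => absurd (hp z h) (not_lt.2 hre)
  rw [hB] at h2
  generalize (-1) ^ p.natDegree * aeval (-z) p = B at h2 hz
  generalize aeval z p = A at h2 hz hpz
  obtain ⟨t, ht⟩ : ∃ t, t = p.leadingCoeff / (2 * p.nextCoeff) := ⟨_, rfl⟩
  have htl : p.leadingCoeff = 2 * t * p.nextCoeff := by
    rw [ht]
    field_simp
  rw [← ht] at hz
  rw [htl] at h2
  have h3 : 2 * t * z.re * normSq (A - B) ≤ normSq A - normSq B :=
    le_of_mul_le_mul_left (by linarith) h1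
  -- At a zero of `routhStep p` one has `A = tz(A - B)`, so the right side becomes `-|B - A|²`,
  -- while the left side is nonnegative by `h3`. Hence `A = B` and then `A = 0`, contradicting
  -- stability of `p`.
  have h4 : normSq A - normSq B - 2 * t * z.re * normSq (A - B) =
      normSq (A - t * (z * (A - B))) - normSq (B - t * (z * (A - B))) := by
    simp [normSq_apply]
    ring
  rw [← hz, sub_self, map_zero, zero_sub] at h4
  have h5 : normSq (B - A) = 0 := le_antisymm (by linarith) (normSq_nonneg _)
  rw [normSq_eq_zero, sub_eq_zero] at h5
  rw [h5, sub_self, mul_zero, mul_zero] at hz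
  exact hpz hz

theorem IsStable.kernelTN {n : ℕ} {p : ℝ[X]} (hp : IsStable p) (hn : p.natDegree = n)
    (hlc : 0 < p.leadingCoeff) : KernelTN (hurwitzKernel n p) := by
  induction n generalizing p with
  | zero =>
    convert kernelTN_double_index hlc.le using 3 with i j
    rw [hurwitzKernel]
    split_ifs with h
    · rw [← descCoeff_zero, hn]
      congr 1
      omega
    · rcases lt_or_gt_of_ne h with h | h
      · exact descCoeff_of_neg (by omega)
      · exact descCoeff_of_lt (by push_cast; omega)
  | succ n ih =>
    have h1 := (hp.two_mul_re_mul_normSq_le hlc (by omega) (z := 0) le_rfl).1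
    have hq := isStable_routhStep hp hlc (by omega)
    have hd := natDegree_routhStep_le hn h1.ne'
    have hcoeff : (routhStep p).coeff n = p.nextCoeff := by
      have h := descCoeff_routhStep hn 1
      have h2 := descCoeff_one (p := p) (by omega)
      rw [if_neg (by decide), mul_zero, sub_zero, descCoeff_succ hd, ← hn, h2, sub_self, descCoeff,
        if_pos (by omega)] at h
      rwa [sub_zero, Int.toNat_natCast] at h
    have hd' : (routhStep p).natDegree = n :=
      le_antisymm hd (le_natDegree_of_ne_zero (hcoeff ▸ h1.ne'))
    have hK := ih hq hd' (by rwa [leadingCoeff, hd', hcoeff])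
    convert hK.rows (α := fun i => if Even i then p.leadingCoeff / p.nextCoeff else 0)
      (β := fun _ => 1) (fun i => ?_) (fun _ => zero_le_one) using 3 with i j
    · rw [hurwitzKernel, descCoeff_eq_routhStep hn h1.ne', hurwitzKernel, hurwitzKernel, one_mul,
        show 2 * j - i - 1 = 2 * j - (i + 1) by ring]
      congr 2
      simp [Int.even_sub]
    · split_ifs
      exacts [(div_pos hlc h1).le, le_rfl]

/-! ### Splitting off even factors. -/

theorem rootMultiplicity_neg_of_comp_neg_X_eq {Q : ℂ[X]} (hQ : Q.comp (-X) = Q) (w : ℂ) :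
    Q.rootMultiplicity (-w) = Q.rootMultiplicity w := by
  have h := rootMultiplicity_comp_C_mul_X_add_C Q (-1) 0 w isUnit_one.neg
  have e : C (-1 : ℂ) * X + C 0 = -X := by simp
  rw [e, hQ] at h
  rw [h]
  simp

/-- An even factor has equal multiplicities at `w` and `-w`, so it cancels from the inequality. -/
theorem ReflectionProperty.of_even_mul {Q q : ℝ[X]} (h : ReflectionProperty (Q * q))
    (hQ : Q.comp (-X) = Q) (h0 : Q * q ≠ 0) : ReflectionProperty q := by
  intro w hw hre
  have h1 := h w (by rw [map_mul, hw, mul_zero]) hre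
  have h2 : (Q * q).map (algebraMap ℝ ℂ) ≠ 0 := map_ne_zero h0
  rw [Polynomial.map_mul] at h1 h2
  have hQ' : (Q.map (algebraMap ℝ ℂ)).comp (-X) = Q.map (algebraMap ℝ ℂ) := by
    conv_rhs => rw [← hQ, map_comp, Polynomial.map_neg, map_X]
  rw [rootMultiplicity_mul h2, rootMultiplicity_mul h2,
    rootMultiplicity_neg_of_comp_neg_X_eq hQ'] at h1
  omega

theorem aeval_conj_eq_zero {p : ℝ[X]} {z : ℂ} (hz : aeval z p = 0) :
    aeval ((starRingEnd ℂ) z) p = 0 := by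
  rw [aeval_conj, hz, map_zero]

theorem aeval_neg_eq_zero_of_reflection {p : ℝ[X]} (h : ReflectionProperty p) (hp : p ≠ 0) {w : ℂ}
    (hw : aeval w p = 0) (hre : 0 < w.re) : aeval (-w) p = 0 := by
  have h0 : p.map (algebraMap ℝ ℂ) ≠ 0 := map_ne_zero hp
  have h1 : 0 < (p.map (algebraMap ℝ ℂ)).rootMultiplicity w := by
    rw [rootMultiplicity_pos h0, IsRoot.def, eval_map, ← aeval_def, hw]
  have h2 := h1.trans_le (h w hw hre)
  rwa [rootMultiplicity_pos h0, IsRoot.def, eval_map, ← aeval_def] at h2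

open Complex in
theorem biquadratic_dvd {p : ℝ[X]} (hp : p ≠ 0) {w : ℂ} (hre : w.re ≠ 0) (him : w.im ≠ 0)
    (hw : aeval w p = 0) (hw' : aeval (-w) p = 0) :
    X ^ 4 + C (2 * (w.im ^ 2 - w.re ^ 2)) * X ^ 2 + C ((w.re ^ 2 + w.im ^ 2) ^ 2) ∣ p := by
  rw [← map_dvd_map' (algebraMap ℝ ℂ)]
  have h0 : p.map (algebraMap ℝ ℂ) ≠ 0 := map_ne_zero hp
  have hs : ({w, (starRingEnd ℂ) w, -w, (starRingEnd ℂ) (-w)} : Multiset ℂ) ≤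
      (p.map (algebraMap ℝ ℂ)).roots := by
    refine (Multiset.le_iff_subset ?_).2 ?_
    -- The four zeros are distinct because `w` lies on neither axis.
    · simp [Complex.ext_iff, him, hre, eq_neg_iff_add_eq_zero, neg_eq_iff_add_eq_zero, ← two_mul]
    · intro v hv
      rw [mem_roots h0, IsRoot.def, eval_map, ← aeval_def]
      simp only [Multiset.insert_eq_cons, Multiset.mem_cons, Multiset.mem_singleton] at hv
      rcases hv with rfl | rfl | rfl | rfl
      exacts [hw, aeval_conj_eq_zero hw, hw', aeval_conj_eq_zero hw']
  have h := (Multiset.prod_X_sub_C_dvd_iff_le_roots h0 _).2 hs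
  convert h using 1
  have h2 : w = w.re + w.im * I := by simp
  have h3 : (C I * C I : ℂ[X]) = -1 := by rw [← C_mul, I_mul_I]; simp
  generalize w.re = x at h2
  generalize w.im = y at h2
  simp only [Multiset.insert_eq_cons, Multiset.map_cons, Multiset.prod_cons, Multiset.map_singleton,
    Multiset.prod_singleton, Polynomial.map_add, Polynomial.map_sub, Polynomial.map_mul,
    Polynomial.map_pow, Polynomial.map_ofNat, map_X, map_C, h2, map_add, map_mul, map_neg,
    conj_ofReal, conj_I, coe_algebraMap, map_sub, map_pow, map_ofNat]
  generalize (C (x : ℂ) : ℂ[X]) = a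
  generalize (C (y : ℂ) : ℂ[X]) = b
  generalize (C I : ℂ[X]) = i at h3
  have h4 : i ^ 2 = -1 := by rw [pow_two, h3]
  have h5 : i ^ 4 = 1 := by rw [show i ^ 4 = (i ^ 2) ^ 2 by ring, h4]; ring
  ring_nf
  rw [h4, h5]
  ring

open Complex in
theorem X_sq_add_C_dvd {p : ℝ[X]} (hp : p ≠ 0) {w : ℂ} (hre : w.re = 0) (him : w.im ≠ 0)
    (hw : aeval w p = 0) : X ^ 2 + C (w.im ^ 2) ∣ p := by
  rw [← map_dvd_map' (algebraMap ℝ ℂ)]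
  have h0 : p.map (algebraMap ℝ ℂ) ≠ 0 := map_ne_zero hp
  have hs : ({w, (starRingEnd ℂ) w} : Multiset ℂ) ≤ (p.map (algebraMap ℝ ℂ)).roots := by
    refine (Multiset.le_iff_subset ?_).2 ?_
    · simp [Complex.ext_iff, him, eq_neg_iff_add_eq_zero, ← two_mul]
    · intro v hv
      rw [mem_roots h0, IsRoot.def, eval_map, ← aeval_def]
      simp only [Multiset.insert_eq_cons, Multiset.mem_cons, Multiset.mem_singleton] at hv
      rcases hv with rfl | rfl
      exacts [hw, aeval_conj_eq_zero hw]
  have h := (Multiset.prod_X_sub_C_dvd_iff_le_roots h0 _).2 hs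
  convert h using 1
  have h2 : w = w.im * I := by simp [Complex.ext_iff, hre]
  have h3 : (C I * C I : ℂ[X]) = -1 := by rw [← C_mul, I_mul_I]; simp
  generalize w.im = y at h2
  simp only [Multiset.insert_eq_cons, Multiset.map_cons, Multiset.prod_cons, Multiset.map_singleton,
    Multiset.prod_singleton, Polynomial.map_add, Polynomial.map_pow, map_X, map_C, h2, map_mul,
    conj_ofReal, conj_I, coe_algebraMap, map_pow, map_neg]
  linear_combination (C (y : ℂ) ^ 2) * h3

/-- Positivity of the leading coefficient and of the constant term pass to a cofactor. -/
theorem IsAdmissible.of_monic_mul {m n : ℕ} {Q q : ℝ[X]} (h : IsAdmissible n (Q * q))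
    (hQ : Q.Monic) (hm : Q.natDegree = m) (h0 : 0 < Q.coeff 0) :
    m ≤ n ∧ IsAdmissible (n - m) q := by
  obtain ⟨h1, h2, h3⟩ := h
  have hq : q ≠ 0 := by
    rintro rfl
    simp at h2
  rw [hQ.natDegree_mul' hq, hm] at h1
  rw [leadingCoeff_mul, hQ.leadingCoeff, one_mul] at h2
  rw [mul_coeff_zero] at h3
  exact ⟨by omega, by omega, h2, (pos_iff_pos_of_mul_pos h3).1 h0⟩

/-! ### Total nonnegativity under the sector condition. -/

open Real in
theorem KernelTN.biquadratic_mul {N d : ℕ} {q : ℝ[X]} (hq : q.natDegree ≤ d) (hN : d + 4 ≤ N)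
    (h : KernelTN fun i j => if 1 ≤ i ∧ i ≤ N then hurwitzKernel d q i j else 0) {ρ φ : ℝ}
    (hρ : 0 ≤ ρ) (hφ : 0 < φ) (hNφ : ((N : ℝ) - 1) * φ ≤ π) :
    KernelTN fun i j => if 1 ≤ i ∧ i ≤ N then
      hurwitzKernel (d + 4) ((X ^ 4 + C (2 * ρ * cos φ) * X ^ 2 + C (ρ ^ 2)) * q) i j else 0 := by
  -- For rows `1 ≤ i ≤ N` a nonzero entry has `0 ≤ 2j - i ≤ d ≤ N - 4`, hence `1 ≤ j ≤ N - 2`. Thus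
  -- the angle condition is `(N - 1)φ ≤ π`.
  have := h.quadratic (r := N - 2) (by omega) (fun i j hj => ?_) (fun i j hj => ?_) hρ hφ
    (by push_cast; linarith)
  · convert this using 3 with i j
    split_ifs
    · rw [hurwitzKernel, hurwitzKernel, hurwitzKernel, hurwitzKernel, descCoeff_biquadratic_mul hq]
      ring_nf
    · simp
  · split_ifs
    · exact descCoeff_of_neg (by omega)
    · rfl
  · split_ifs
    · exact descCoeff_of_lt (by omega)
    · rfl

-- The row window `N` stays fixed while the degree `d` drops as even factors are removed, so the
-- angle condition is inherited by the cofactor.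
open Real in
theorem kernelTN_truncate_hurwitzKernel {N : ℕ} (d : ℕ) (hd : d ≤ N) (p : ℝ[X])
    (hp : IsAdmissible d p) (href : ReflectionProperty p)
    (hsec : ∀ w : ℂ, aeval w p = 0 → 0 < w.re →
      w.im ≠ 0 ∧ ((N : ℝ) - 1) * (π - 2 * |w.arg|) ≤ π) :
    KernelTN fun i j => if 1 ≤ i ∧ i ≤ N then hurwitzKernel d p i j else 0 := by
  induction d using Nat.strong_induction_on generalizing p with
  | _ d ih =>
  have hp0 : p ≠ 0 := by
    rintro rfl
    simpa using hp.2.1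
  by_cases hst : IsStable p
  · exact (hst.kernelTN hp.1 hp.2.1).truncate fun i => 1 ≤ i ∧ i ≤ N
  simp only [IsStable, not_forall, not_lt] at hst
  obtain ⟨w, hw, hre⟩ := hst
  rcases hre.eq_or_lt with hre | hre
  · have him : w.im ≠ 0 := fun him => by
      have : w = 0 := Complex.ext hre.symm him
      rw [this, ← coeff_zero_eq_aeval_zero'] at hw
      simp [hp.2.2.ne'] at hw
    obtain ⟨q, rfl⟩ := X_sq_add_C_dvd hp0 hre.symm him hw
    have hw2 : 0 < w.im ^ 2 := by positivity
    generalize w.im ^ 2 = a at *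
    have hQd : (X ^ 2 + C a : ℝ[X]).natDegree = 2 := by compute_degree!
    obtain ⟨h2, hq⟩ := hp.of_monic_mul (by monicity!) hQd (by simpa using hw2)
    obtain ⟨e, rfl⟩ : ∃ e, d = e + 2 := ⟨d - 2, by omega⟩
    rw [Nat.add_sub_cancel] at hq
    have hK := ih e (by omega) (by omega) q hq (href.of_even_mul (by simp) hp0)
      fun v hv => hsec v (by rw [map_mul, hv, mul_zero])
    convert hK.columns (x := fun _ => a) fun _ => hw2.le using 3 with i j
    split_ifs
    · rw [hurwitzKernel, hurwitzKernel, hurwitzKernel, descCoeff_X_sq_add_C_mul hq.1.le]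
      ring_nf
    · simp
  · have hw' := aeval_neg_eq_zero_of_reflection href hp0 hw hre
    obtain ⟨him, hsw⟩ := hsec w hw hre
    have harg : |w.arg| < π / 2 := Complex.abs_arg_lt_pi_div_two_iff.2 (Or.inl hre)
    obtain ⟨q, rfl⟩ := biquadratic_dvd hp0 hre.ne' him hw hw'
    have hcos : 2 * (w.im ^ 2 - w.re ^ 2) =
        2 * (w.re ^ 2 + w.im ^ 2) * cos (π - 2 * |w.arg|) := by
      rw [cos_pi_sub, cos_two_mul, cos_abs]
      have h1 : w.re ^ 2 + w.im ^ 2 = ‖w‖ ^ 2 := by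
        rw [Complex.sq_norm, Complex.normSq_apply]
        ring
      have h2 := Complex.norm_mul_cos_arg w
      have h3 : (w.re ^ 2 + w.im ^ 2) * cos w.arg ^ 2 = w.re ^ 2 := by
        rw [h1, ← mul_pow, h2]
      linear_combination 4 * h3
    rw [hcos] at hp href hsec hp0 hw hw' ⊢
    have hρ : 0 < w.re ^ 2 + w.im ^ 2 := by positivity
    generalize w.re ^ 2 + w.im ^ 2 = ρ at *
    have hφ : 0 < π - 2 * |w.arg| := by linarith
    generalize π - 2 * |w.arg| = φ at *
    have hQd : (X ^ 4 + C (2 * ρ * cos φ) * X ^ 2 + C (ρ ^ 2) : ℝ[X]).natDegree = 4 := by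
      compute_degree!
    obtain ⟨h2, hq⟩ := hp.of_monic_mul (by monicity!) hQd (by
      rw [coeff_zero_eq_eval_zero]
      simpa using pow_pos hρ 2)
    obtain ⟨e, rfl⟩ : ∃ e, d = e + 4 := ⟨d - 4, by omega⟩
    rw [Nat.add_sub_cancel] at hq
    have hK := ih e (by omega) (by omega) q hq
      (href.of_even_mul (by simp [Even.neg_pow (show Even 4 by decide)]) hp0)
      fun v hv => hsec v (by rw [map_mul, hv, mul_zero])
    exact hK.biquadratic_mul hq.1.le hd hρ.le hφ hsw

theorem totallyNonneg_hurwitzMatrix {n : ℕ} {p : ℝ[X]}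
    (h : KernelTN fun i j => if 1 ≤ i ∧ i ≤ n then hurwitzKernel n p i j else 0) :
    TotallyNonneg (hurwitzMatrix n p) := by
  intro k r c hr hc
  have := h k (fun i => ((r i : ℕ) : ℤ) + 1) (fun i => ((c i : ℕ) : ℤ) + 1)
    (fun i j hij => by have := hr hij; simp only; omega)
    (fun i j hij => by have := hc hij; simp only; omega)
  convert this using 2
  ext i j
  have := (r i).2
  exact (if_pos (c := 1 ≤ ((r i : ℕ) : ℤ) + 1 ∧ ((r i : ℕ) : ℤ) + 1 ≤ n)
    ⟨by omega, by omega⟩).symm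

theorem IsQuasiStable.totallyNonneg {n : ℕ} {p : ℝ[X]} (h : IsQuasiStable p)
    (hp : IsAdmissible n p) : TotallyNonneg (hurwitzMatrix n p) :=
  totallyNonneg_hurwitzMatrix <| kernelTN_truncate_hurwitzKernel n le_rfl p hp
    (fun w hw hre => absurd (h w hw) (not_le.2 hre))
    fun w hw hre => absurd (h w hw) (not_le.2 hre)

theorem totallyNonneg_of_noZerosInSector {n : ℕ} (hn : 4 ≤ n) {p : ℝ[X]} (hp : IsAdmissible n p)
    (hs : NoZerosInSector (Real.pi / 2 * (((n : ℝ) - 2) / ((n : ℝ) - 1))) p)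
    (href : ReflectionProperty p) : TotallyNonneg (hurwitzMatrix n p) := by
  have hn' : (4 : ℝ) ≤ n := by exact_mod_cast hn
  have hn1 : (0 : ℝ) < n - 1 := by linarith
  refine totallyNonneg_hurwitzMatrix <| kernelTN_truncate_hurwitzKernel n le_rfl p hp href
    fun w hw hre => ?_
  have h := not_lt.1 (hs w hw)
  constructor
  · intro him
    rw [Complex.arg_eq_zero_iff.2 ⟨hre.le, him⟩, abs_zero] at h
    have : 0 < Real.pi / 2 * (((n : ℝ) - 2) / ((n : ℝ) - 1)) :=
      mul_pos Real.pi_div_two_pos (div_pos (by linarith) hn1)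
    linarith
  · have h2 := mul_le_mul_of_nonneg_left h hn1.le
    have h3 : ((n : ℝ) - 1) * (Real.pi / 2 * ((n - 2) / (n - 1))) = Real.pi / 2 * (n - 2) := by
      field_simp
    rw [h3] at h2
    linarith

/-! ### The converse in degree at most 3. -/

theorem TotallyNonneg.apply_nonneg {m n : ℕ} {A : Matrix (Fin m) (Fin n) ℝ} (h : TotallyNonneg A)
    (i : Fin m) (j : Fin n) : 0 ≤ A i j := by
  simpa using h 1 (fun _ => i) (fun _ => j) (Subsingleton.strictMono _) (Subsingleton.strictMono _)

theorem isQuasiStable_of_totallyNonneg {n : ℕ} (h1 : 1 ≤ n) (h3 : n ≤ 3) {p : ℝ[X]}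
    (hp : IsAdmissible n p) (h : TotallyNonneg (hurwitzMatrix n p)) : IsQuasiStable p := by
  obtain ⟨hd, hl, h0⟩ := hp
  intro z hz
  by_contra! hre
  have hre0 := congrArg Complex.re hz
  have him0 := congrArg Complex.im hz
  rw [aeval_eq_sum_range, hd] at hre0 him0
  rw [leadingCoeff, hd] at hl
  interval_cases n
  · simp [Finset.sum_range_succ] at hre0 him0
    nlinarith
  · have ha := h.apply_nonneg 0 0
    simp [hurwitzMatrix, descCoeff] at ha
    simp [Finset.sum_range_succ, pow_two] at hre0 him0
    generalize z.re = x at *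
    generalize z.im = y at *
    have hy : y = 0 := by
      have : (p.coeff 1 + 2 * p.coeff 2 * x) * y = 0 := by linear_combination him0
      exact (mul_eq_zero.1 this).resolve_left (by positivity)
    subst hy
    have : 0 < p.coeff 0 + p.coeff 1 * x + p.coeff 2 * (x * x) := by positivity
    linarith
  · have ha := h.apply_nonneg 0 0
    have hb := h.apply_nonneg 1 1
    have hc := h 2 ![0, 1] ![0, 1] (by decide) (by decide)
    rw [Matrix.det_fin_two] at hc
    simp [hurwitzMatrix, descCoeff] at ha hb hc
    simp [Finset.sum_range_succ, pow_succ] at hre0 him0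
    generalize z.re = x at *
    generalize z.im = y at *
    by_cases hy : y = 0
    · subst hy
      have : 0 < p.coeff 0 + p.coeff 1 * x + p.coeff 2 * (x * x) + p.coeff 3 * (x * x * x) := by
        positivity
      linarith
    · have him : p.coeff 3 * y ^ 2 = 3 * p.coeff 3 * x ^ 2 + 2 * p.coeff 2 * x + p.coeff 1 :=
        mul_right_cancel₀ hy (by linear_combination -him0)
      -- If this coefficient vanished, the minor `a₁a₂ - a₀a₃` would be negative.
      have hb' : 0 < p.coeff 1 := by
        by_contra hb'
        have : p.coeff 1 = 0 := by linarith
        rw [this] at hc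
        nlinarith [mul_pos h0 hl]
      have hneg : 0 < 8 * p.coeff 3 ^ 2 * x ^ 3 + 8 * p.coeff 3 * p.coeff 2 * x ^ 2 +
          2 * p.coeff 3 * p.coeff 1 * x + 2 * p.coeff 2 ^ 2 * x := by positivity
      -- Eliminating `y²` gives a cubic in `x = Re z` whose constant term is the minor `a₁a₂ -
      -- a₀a₃`, so it has no positive zero.
      have : 8 * p.coeff 3 ^ 2 * x ^ 3 + 8 * p.coeff 3 * p.coeff 2 * x ^ 2 +
          2 * p.coeff 3 * p.coeff 1 * x + 2 * p.coeff 2 ^ 2 * x +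
          (p.coeff 2 * p.coeff 1 - p.coeff 0 * p.coeff 3) = 0 := by
        linear_combination (-p.coeff 3) * hre0 - (3 * p.coeff 3 * x + p.coeff 2) * him
      linarith

/-! ### Sharpness of the angle. -/

theorem comp_neg_X_eq_neg_of_forall_even {F : ℝ[X]} (h : ∀ j, F.coeff (2 * j) = 0) :
    F.comp (-X) = -F := by
  ext m
  rw [coeff_comp_neg_X, coeff_neg]
  rcases m.even_or_odd' with ⟨j, rfl | rfl⟩
  · rw [h, mul_zero, neg_zero]
  · rw [Odd.neg_one_pow ⟨j, rfl⟩, neg_one_mul]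

theorem odd_natDegree_of_comp_neg_X_eq_neg {F : ℝ[X]} (h0 : F ≠ 0) (h : F.comp (-X) = -F) :
    Odd F.natDegree := by
  by_contra hodd
  have h1 := congrArg (fun G => coeff G F.natDegree) h
  simp only [coeff_comp_neg_X, coeff_neg, (Nat.not_odd_iff_even.1 hodd).neg_one_pow] at h1
  have : F.leadingCoeff = 0 := by rw [leadingCoeff]; linarith
  exact h0 (leadingCoeff_eq_zero.1 this)

/-- The product is odd, so `(1 - X)^l` divides it, and by coprimality divides `V`. Since `(1 -
X²)^l` is even, the cofactor `W` of `V` is odd. -/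
theorem exists_odd_natDegree_of_mul_X_add_one_pow {V : ℝ[X]} (hV : V ≠ 0) {l : ℕ}
    (h : ∀ j, (V * (X + 1) ^ l).coeff (2 * j) = 0) : ∃ d, Odd d ∧ V.natDegree = l + d := by
  have hF := comp_neg_X_eq_neg_of_forall_even h
  have hq : ((X + 1 : ℝ[X]) ^ l).comp (-X) = (1 - X) ^ l := by
    simp only [pow_comp, add_comp, X_comp, one_comp]
    ring
  have hq' : ((1 - X : ℝ[X]) ^ l).comp (-X) = (X + 1) ^ l := by
    simp only [pow_comp, sub_comp, X_comp, one_comp]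
    ring
  have hcop : IsCoprime ((1 - X : ℝ[X]) ^ l) ((X + 1) ^ l) := by
    refine IsCoprime.pow ⟨C (1 / 2), C (1 / 2), ?_⟩
    have : (C (1 / 2) + C (1 / 2) : ℝ[X]) = 1 := by rw [← C_add]; norm_num
    linear_combination this
  have hdvd : (1 - X : ℝ[X]) ^ l ∣ V * (X + 1) ^ l := by
    rw [← neg_neg (V * (X + 1) ^ l), ← hF, mul_comp, hq]
    exact (Dvd.intro_left _ rfl).neg_right
  obtain ⟨W, rfl⟩ := hcop.dvd_of_dvd_mul_right hdvd
  have h1 : (1 - X : ℝ[X]) ^ l ≠ 0 := left_ne_zero_of_mul hV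
  have hW : W ≠ 0 := right_ne_zero_of_mul hV
  have h2 : (X + 1 : ℝ[X]) ^ l ≠ 0 := (monic_X_add_C (1 : ℝ)).pow l |>.ne_zero
  refine ⟨W.natDegree, odd_natDegree_of_comp_neg_X_eq_neg hW ?_, ?_⟩
  · rw [mul_comp, mul_comp, hq, hq'] at hF
    exact mul_left_cancel₀ (mul_ne_zero h1 h2) (by linear_combination hF)
  · rw [natDegree_mul h1 hW, natDegree_pow, show (1 - X : ℝ[X]) = -(X - C 1) by simp,
      natDegree_neg, natDegree_X_sub_C, mul_one]

/-- The rows `1, …, l, l + 2, l + 4` of a Hurwitz matrix. -/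
def selectedRow (l : ℕ) (s : Fin (l + 2)) : ℕ :=
  if (s : ℕ) < l then s + 1 else 2 * s - l + 2

theorem selectedRow_strictMono (l : ℕ) : StrictMono (selectedRow l) := by
  intro s t hst
  have : (s : ℕ) < t := hst
  unfold selectedRow
  split_ifs <;> omega

theorem selectedRow_pos {l : ℕ} (s : Fin (l + 2)) : 1 ≤ selectedRow l s := by
  unfold selectedRow
  split_ifs <;> omega

theorem selectedRow_le {l : ℕ} (s : Fin (l + 2)) : selectedRow l s ≤ l + 4 := by
  unfold selectedRow
  split_ifs <;> omega

theorem not_odd_of_selectedRow_eq {l : ℕ} {s : Fin (l + 2)} {d : ℕ} (h : selectedRow l s = l + d) :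
    ¬ Odd d := by
  rintro ⟨k, rfl⟩
  unfold selectedRow at h
  split_ifs at h <;> omega

theorem natDegree_X_add_one_pow (l : ℕ) : ((X + 1 : ℝ[X]) ^ l).natDegree = l := by
  rw [natDegree_pow, ← C_1, natDegree_X_add_C, mul_one]

/-- Binomial coefficients are symmetric, so descending and ascending coefficients agree. -/
theorem descCoeff_X_add_one_pow (l : ℕ) (m a : ℕ) :
    descCoeff l ((X + 1) ^ l) ((m : ℤ) - a) = (X ^ a * (X + 1 : ℝ[X]) ^ l).coeff m := by
  rw [coeff_X_pow_mul']
  split_ifs with h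
  · rcases le_or_gt (m - a) l with h1 | h1
    · rw [descCoeff, if_pos (by omega), coeff_X_add_one_pow, coeff_X_add_one_pow,
        ← Nat.choose_symm h1]
      congr 2
      omega
    · rw [descCoeff_of_lt (by omega), coeff_X_add_one_pow, Nat.choose_eq_zero_of_lt h1,
        Nat.cast_zero]
  · exact descCoeff_of_neg (by omega)

/-- Stability gives nonnegativity. A left null vector would give a nonzero `V`, with exponents among
the selected rows, such that `V (X + 1)^l` is odd; then `deg V - l` is odd, but the selected rows
avoid `l + 1` and `l + 3`. -/
theorem det_hurwitzKernel_X_add_one_pow_pos (l : ℕ) :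
    0 < (Matrix.of fun s t : Fin (l + 2) =>
      hurwitzKernel l ((X + 1) ^ l) (selectedRow l s) ((t : ℕ) + 1 : ℤ)).det := by
  refine lt_of_le_of_ne ?_ (Ne.symm fun hdet => ?_)
  · have hst : IsStable ((X + 1) ^ l) := by
      intro z hz
      rw [map_pow, map_add, aeval_X, map_one] at hz
      have : z = -1 := eq_neg_of_add_eq_zero_left (eq_zero_of_pow_eq_zero hz)
      simp [this]
    refine hst.kernelTN (natDegree_X_add_one_pow l) ?_ (l + 2) (fun s => (selectedRow l s : ℤ))
      (fun t => ((t : ℕ) + 1 : ℤ)) (fun s t hst => ?_) fun s t hst => ?_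
    · rw [← C_1, ((monic_X_add_C (1 : ℝ)).pow l).leadingCoeff]
      exact one_pos
    · exact Nat.cast_lt.2 (selectedRow_strictMono l hst)
    · have : (s : ℕ) < t := hst
      simp only
      omega
  · obtain ⟨v, hv0, hv⟩ := Matrix.exists_vecMul_eq_zero_iff.2 hdet
    set V : ℝ[X] := ∑ s, C (v s) * X ^ selectedRow l s with hVdef
    have hcoeff : ∀ m, V.coeff m = ∑ s, if m = selectedRow l s then v s else 0 := fun m => by
      simp [hVdef, coeff_X_pow]
    have hV : V ≠ 0 := by
      obtain ⟨s, hs⟩ := Function.ne_iff.1 hv0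
      intro h0
      have := hcoeff (selectedRow l s)
      simp [h0, (selectedRow_strictMono l).injective.eq_iff] at this
      exact hs this.symm
    have hprod : ∀ m : ℕ, (V * (X + 1) ^ l).coeff m =
        ∑ s, v s * descCoeff l ((X + 1) ^ l) ((m : ℤ) - selectedRow l s) := fun m => by
      rw [hVdef, Finset.sum_mul, finsetSum_coeff]
      refine Finset.sum_congr rfl fun s _ => ?_
      rw [mul_assoc, coeff_C_mul, descCoeff_X_add_one_pow]
    obtain ⟨d, hd, hVd⟩ := exists_odd_natDegree_of_mul_X_add_one_pow (l := l) hV fun j => by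
      rw [hprod]
      by_cases hj : 1 ≤ j ∧ j ≤ l + 2
      · have := congrFun hv ⟨j - 1, by omega⟩
        simp only [Matrix.vecMul, dotProduct, Matrix.of_apply, Pi.zero_apply, hurwitzKernel] at this
        rw [← this]
        refine Finset.sum_congr rfl fun s _ => ?_
        congr 2
        omega
      -- Outside the minor's columns the even coefficients vanish because `V` has exponents between
      -- `1` and `l + 4`.
      · refine Finset.sum_eq_zero fun s _ => mul_eq_zero_of_right _ ?_
        have h1 := selectedRow_pos s
        have h2 := selectedRow_le s
        rcases Nat.eq_zero_or_pos j with h | h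
        · exact descCoeff_of_neg (by omega)
        · exact descCoeff_of_lt (by push_cast; omega)
    have hne : V.coeff (l + d) ≠ 0 := by
      rw [← hVd]
      exact leadingCoeff_ne_zero.2 hV
    rw [hcoeff] at hne
    obtain ⟨s, -, hs⟩ := Finset.exists_ne_zero_of_sum_ne_zero hne
    exact not_odd_of_selectedRow_eq (of_not_not fun h => hs (if_neg fun h' => h h'.symm)) hd

open Real in
/-- A minor of `K T`, with `T` the banded Toeplitz matrix of `u² + 2 cos φ u + 1`. -/
theorem det_quadratic_columns {r : ℕ} {K : Fin (r + 1) → ℕ → ℝ} (h0 : ∀ s, K s 0 = 0)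
    (hr : ∀ s, K s (r + 2) = 0) {φ : ℝ} (hsin : ∀ i : ℕ, 1 ≤ i → i ≤ r + 1 → sin (i * φ) ≠ 0) :
    (Matrix.of fun s t : Fin (r + 1) =>
      K s (t + 2) + 2 * cos φ * K s (t + 1) + K s t).det =
    (Matrix.of fun s t : Fin (r + 1) => K s (t + 1)).det *
      ∏ t : Fin (r + 1), (sin ((t + 2 : ℕ) * φ) / sin ((t + 1 : ℕ) * φ)) := by
  let x : ℕ → ℝ := fun t => sin ((t + 2 : ℕ) * φ) / sin ((t + 1 : ℕ) * φ)
  have hx : ∀ t ≤ r, 2 * cos φ = x t + sin ((t : ℕ) * φ) / sin ((t + 1 : ℕ) * φ) := fun t ht => by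
    have hs := hsin (t + 1) (by omega) (by omega)
    have e1 : ((t + 2 : ℕ) : ℝ) * φ = ((t + 1 : ℕ) : ℝ) * φ + φ := by push_cast; ring
    have e2 : (t : ℝ) * φ = ((t + 1 : ℕ) : ℝ) * φ - φ := by push_cast; ring
    simp only [x]
    rw [e1, e2, sin_add, sin_sub, ← add_div, eq_div_iff hs]
    ring
  have h1 : (Matrix.of fun s t : Fin (r + 1) => K s (t + 2) + x t * K s (t + 1)).det =
      (Matrix.of fun s t : Fin (r + 1) => K s (t + 2) + 2 * cos φ * K s (t + 1) + K s t).det := by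
    -- Gaussian elimination on columns: the relevant block of `T` is tridiagonal with successive
    -- pivots `x t`, and clearing its superdiagonal leaves the lower bidiagonal `L` below.
    refine Matrix.det_eq_of_forall_col_eq_smul_add_pred
      (fun t => -(sin ((t + 1 : ℕ) * φ) / sin ((t + 2 : ℕ) * φ))) (fun s => ?_) fun s t => ?_
    · simp [hx 0 (by omega), h0]
    · have ht := t.2
      have hs1 := hsin (t + 1) (by omega) (by omega)
      have hs2 := hsin (t + 2) (by omega) (by omega)
      simp only [Matrix.of_apply, Fin.val_succ, Fin.val_castSucc]
      rw [hx (t + 1) (by omega)]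
      have : sin ((t + 1 : ℕ) * φ) / sin ((t + 2 : ℕ) * φ) * x t = 1 := by
        simp only [x]
        rw [div_mul_div_cancel₀ hs2, div_self hs1]
      linear_combination (K s (t + 1)) * this
  rw [← h1]
  let L : Matrix (Fin (r + 1)) (Fin (r + 1)) ℝ := Matrix.of fun u t =>
    if u = t then x t else if (u : ℕ) = t + 1 then 1 else 0
  have hL : L.det = ∏ t : Fin (r + 1), x t := by
    rw [Matrix.det_of_isLowerTriangular]
    · simp [L]
    · intro u t hut
      have : (u : ℕ) < t := hut
      simp only [L, Matrix.of_apply]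
      rw [if_neg (by omega), if_neg (by omega)]
  have hmul : (Matrix.of fun s t : Fin (r + 1) => K s (t + 2) + x t * K s (t + 1)) =
      (Matrix.of fun s t : Fin (r + 1) => K s (t + 1)) * L := by
    ext s t
    rw [Matrix.mul_apply]
    simp only [Matrix.of_apply, L]
    have hsplit : ∀ u : Fin (r + 1), K s (u + 1) *
        (if u = t then x t else if (u : ℕ) = t + 1 then 1 else 0) =
        (if u = t then x t * K s (t + 1) else 0) +
        if (u : ℕ) = t + 1 then K s (t + 2) else 0 := fun u => by
      by_cases h : u = t
      · subst h
        simp [mul_comm]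
      · by_cases h' : (u : ℕ) = t + 1 <;> simp [h, h']
    rw [Finset.sum_congr rfl fun u _ => hsplit u, Finset.sum_add_distrib,
      Finset.sum_ite_eq' , if_pos (Finset.mem_univ _), add_comm]
    congr 1
    rcases lt_or_eq_of_le (Nat.lt_succ_iff.1 t.2) with h | h
    · rw [Finset.sum_eq_single (⟨t + 1, by omega⟩ : Fin (r + 1))]
      · simp
      · intro b _ hb
        exact if_neg fun hb' => hb (Fin.ext hb')
      · simp
    · rw [h, hr]
      simp
  rw [hmul, Matrix.det_mul, hL]

open Real in
theorem noZerosInSector_biquadratic_mul_X_add_one_pow {α φ : ℝ} (h0 : 0 ≤ φ) (hα : α ≤ (π - φ) / 2)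
    (l : ℕ) : NoZerosInSector α ((X ^ 4 + C (2 * cos φ) * X ^ 2 + C 1) * (X + 1) ^ l) := by
  intro z hz harg
  rw [map_mul, mul_eq_zero] at hz
  rcases hz with hz | hz
  · have hz' : z ^ 4 + 2 * Complex.cos φ * z ^ 2 + 1 = 0 := by simpa using hz
    have hsq : (z ^ 2 + Complex.cos φ) ^ 2 = (Complex.sin φ * Complex.I) ^ 2 := by
      rw [mul_pow, Complex.I_sq]
      linear_combination hz' + Complex.sin_sq_add_cos_sq (φ : ℂ)
    have h1 : (z ^ 2).re = -cos φ ∧ Complex.normSq (z ^ 2) = 1 := by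
      rw [← Complex.ofReal_cos, ← Complex.ofReal_sin] at hsq
      have hsc := sin_sq_add_cos_sq φ
      rcases sq_eq_sq_iff_eq_or_eq_neg.1 hsq with h | h
      · have h2 : z ^ 2 = ⟨-cos φ, sin φ⟩ := by
          rw [eq_sub_of_add_eq h]
          simp [Complex.ext_iff, -Complex.ofReal_cos, -Complex.ofReal_sin]
        rw [h2, Complex.normSq_mk]
        exact ⟨rfl, by linarith⟩
      · have h2 : z ^ 2 = ⟨-cos φ, -sin φ⟩ := by
          rw [eq_sub_of_add_eq h]
          simp [Complex.ext_iff, -Complex.ofReal_cos, -Complex.ofReal_sin]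
        rw [h2, Complex.normSq_mk]
        exact ⟨rfl, by linarith⟩
    obtain ⟨hre, hnorm⟩ := h1
    have hn : Complex.normSq z = 1 := by
      rw [map_pow] at hnorm
      exact (pow_eq_one_iff_of_nonneg (Complex.normSq_nonneg z) two_ne_zero).1 hnorm
    have hn1 : ‖z‖ = 1 := by
      rw [Complex.normSq_eq_norm_sq] at hn
      exact (pow_eq_one_iff_of_nonneg (norm_nonneg z) two_ne_zero).1 hn
    have hc := Complex.norm_mul_cos_arg z
    rw [hn1, one_mul] at hc
    -- The zeros of the quartic satisfy `z² = exp(±i(π - φ))`.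
    have hcos : cos (2 * |z.arg|) = cos (π - φ) := by
      rw [cos_pi_sub, cos_two_mul, cos_abs, hc, ← hre]
      rw [Complex.normSq_apply] at hn
      simp only [pow_two, Complex.mul_re]
      linarith
    have := cos_lt_cos_of_nonneg_of_le_pi (x := 2 * |z.arg|) (y := π - φ) (by positivity)
      (by linarith) (by linarith)
    linarith
  · rw [map_pow, map_add, aeval_X, map_one] at hz
    rw [eq_neg_of_add_eq_zero_left (eq_zero_of_pow_eq_zero hz), Complex.arg_neg_one,
      abs_of_pos pi_pos] at harg
    linarith [pi_pos]

theorem reflectionProperty_even_mul_X_add_one_pow {Q : ℝ[X]} (hQ0 : Q ≠ 0) (hQ : Q.comp (-X) = Q)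
    (l : ℕ) : ReflectionProperty (Q * (X + 1) ^ l) := by
  intro w _ hre
  have h2 : (Q * (X + 1) ^ l).map (algebraMap ℝ ℂ) ≠ 0 :=
    map_ne_zero (mul_ne_zero hQ0 ((monic_X_add_C (1 : ℝ)).pow l).ne_zero)
  have hQ' : (Q.map (algebraMap ℝ ℂ)).comp (-X) = Q.map (algebraMap ℝ ℂ) := by
    conv_rhs => rw [← hQ, map_comp, Polynomial.map_neg, map_X]
  rw [Polynomial.map_mul] at h2 ⊢
  rw [rootMultiplicity_mul h2, rootMultiplicity_mul h2, rootMultiplicity_neg_of_comp_neg_X_eq hQ',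
    (rootMultiplicity_eq_zero_iff (p := ((X + 1 : ℝ[X]) ^ l).map (algebraMap ℝ ℂ)) (x := w)).2]
  · omega
  · intro h
    exfalso
    rw [IsRoot.def, eval_map, ← aeval_def, map_pow, map_add, aeval_X, map_one] at h
    have := eq_neg_of_add_eq_zero_left (eq_zero_of_pow_eq_zero h)
    rw [this] at hre
    norm_num at hre

open Real in
theorem exists_not_totallyNonneg {n : ℕ} (hn : 4 ≤ n) {α : ℝ}
    (hα : α < π / 2 * (((n : ℝ) - 2) / ((n : ℝ) - 1))) :
    ∃ p : ℝ[X], IsAdmissible n p ∧ NoZerosInSector α p ∧ ReflectionProperty p ∧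
      ¬ TotallyNonneg (hurwitzMatrix n p) := by
  obtain ⟨l, rfl⟩ : ∃ l, n = l + 4 := ⟨n - 4, by omega⟩
  push_cast at hα
  have hl : (0 : ℝ) ≤ l := l.cast_nonneg
  -- The bound `π - 2α` keeps the zeros out of the sector. The bound `π/(l + 2)` makes `sin((l +
  -- 3)φ)` the first negative sine.
  have hlt : π / (l + 3) < min (π - 2 * α) (π / (l + 2)) := by
    refine lt_min ?_ ?_
    · have : π / (l + 3) = π - 2 * (π / 2 * (((l : ℝ) + 4 - 2) / ((l : ℝ) + 4 - 1))) := by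
        rw [show (l : ℝ) + 4 - 1 = l + 3 by ring]
        field_simp
        ring
      linarith
    · exact div_lt_div_of_pos_left pi_pos (by positivity) (by linarith)
  obtain ⟨φ, hφ1, hφ2⟩ := exists_between hlt
  obtain ⟨hφ3, hφ4⟩ := lt_min_iff.1 hφ2
  rw [div_lt_iff₀ (by positivity)] at hφ1
  rw [lt_div_iff₀ (by positivity)] at hφ4
  have hφ : 0 < φ := by
    by_contra h
    nlinarith [pi_pos]
  set Q : ℝ[X] := X ^ 4 + C (2 * cos φ) * X ^ 2 + C 1 with hQ
  have hQm : Q.Monic := by rw [hQ]; monicity!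
  have hQd : Q.natDegree = 4 := by rw [hQ]; compute_degree!
  have hqm : ((X + 1 : ℝ[X]) ^ l).Monic := (monic_X_add_C (1 : ℝ)).pow l
  have hqd := natDegree_X_add_one_pow l
  have hpd : (Q * (X + 1) ^ l).natDegree = l + 4 := by
    rw [hQm.natDegree_mul hqm, hQd, hqd, add_comm]
  refine ⟨Q * (X + 1) ^ l, ⟨hpd, ?_, ?_⟩,
    noZerosInSector_biquadratic_mul_X_add_one_pow hφ.le (by linarith) l,
    reflectionProperty_even_mul_X_add_one_pow hQm.ne_zero
      (by simp [hQ, Even.neg_pow (show Even 4 by decide)]) l, fun htn => ?_⟩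
  · rw [(hQm.mul hqm).leadingCoeff]
    exact one_pos
  · rw [coeff_zero_eq_eval_zero]
    simp [hQ]
  -- The minor has columns `2, …, l + 3`, while the selected rows for `(X + 1)^l` live in columns
  -- `1, …, l + 2`; this shift puts `2 cos φ` on the diagonal of the Toeplitz block.
  · have h := htn (l + 2)
      (fun s => ⟨selectedRow l s - 1, by have := selectedRow_pos s; have := selectedRow_le s; omega⟩)
      (fun t => ⟨t + 1, by omega⟩)
      (fun s t hst => Nat.sub_lt_sub_right (selectedRow_pos s) (selectedRow_strictMono l hst))
      (fun s t hst => Nat.add_lt_add_right (Fin.lt_def.1 hst) 1)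
    have hsin : ∀ i : ℕ, 1 ≤ i → i ≤ l + 2 → 0 < sin (i * φ) := fun i h1 h2 => by
      have h1' : (1 : ℝ) ≤ i := by exact_mod_cast h1
      have h2' : (i : ℝ) ≤ l + 2 := by exact_mod_cast h2
      exact sin_pos_of_pos_of_lt_pi (by positivity) (by nlinarith)
    have hdet := det_quadratic_columns (r := l + 1)
      (K := fun s t => hurwitzKernel l ((X + 1) ^ l) (selectedRow l s) t)
      (fun s => descCoeff_of_neg (by have := selectedRow_pos s; push_cast; omega))
      (fun s => descCoeff_of_lt (by have := selectedRow_le s; push_cast; omega))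
      (φ := φ) (fun i h1 h2 => (hsin i h1 h2).ne')
    have hneg : sin ((l + 3 : ℕ) * φ) < 0 := by
      have : sin ((l + 3 : ℕ) * φ) = -sin ((l + 3 : ℕ) * φ - π) := by
        rw [sin_sub_pi, neg_neg]
      rw [this, neg_lt_zero]
      push_cast
      exact sin_pos_of_pos_of_lt_pi (by linarith) (by nlinarith)
    have hpos := det_hurwitzKernel_X_add_one_pow_pos l
    refine absurd h (not_le.2 ?_)
    have hentry : (hurwitzMatrix (l + 4) (Q * (X + 1) ^ l)).submatrix
        (fun s : Fin (l + 2) => ⟨selectedRow l s - 1, by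
          have := selectedRow_pos s; have := selectedRow_le s; omega⟩)
        (fun t : Fin (l + 2) => ⟨t + 1, by omega⟩) = Matrix.of fun s t : Fin (l + 2) =>
          hurwitzKernel l ((X + 1) ^ l) (selectedRow l s) ((t + 2 : ℕ) : ℤ) +
          2 * cos φ * hurwitzKernel l ((X + 1) ^ l) (selectedRow l s) ((t + 1 : ℕ) : ℤ) +
          hurwitzKernel l ((X + 1) ^ l) (selectedRow l s) ((t : ℕ) : ℤ) := by
      ext s t
      have := selectedRow_pos s
      simp only [hurwitzMatrix, Matrix.submatrix_apply, Matrix.of_apply, hurwitzKernel]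
      rw [descCoeff_biquadratic_mul hqd.le, one_mul]
      congr 2
      · congr 1
        push_cast [this]
        ring
      · congr 2
        push_cast [this]
        ring
      · push_cast [this]
        ring
    rw [hentry, hdet]
    refine mul_neg_of_pos_of_neg (by exact_mod_cast hpos) ?_
    rw [Fin.prod_univ_castSucc]
    refine mul_neg_of_pos_of_neg (Finset.prod_pos fun t _ => ?_) ?_
    · exact div_pos (hsin _ (by omega) (by have := t.2; simp only [Fin.val_castSucc]; omega))
        (hsin _ (by omega) (by have := t.2; simp only [Fin.val_castSucc]; omega))
    · exact div_neg_of_neg_of_pos hneg (hsin _ (by omega) (by simp))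

theorem theorem2p3 :
    (∀ n : ℕ, 4 ≤ n →
      (∀ p : ℝ[X], IsAdmissible n p →
        NoZerosInSector (Real.pi / 2 * (((n : ℝ) - 2) / ((n : ℝ) - 1))) p →
        ReflectionProperty p →
        TotallyNonneg (hurwitzMatrix n p)) ∧
      (∀ α : ℝ, α < Real.pi / 2 * (((n : ℝ) - 2) / ((n : ℝ) - 1)) →
        ∃ p : ℝ[X], IsAdmissible n p ∧ NoZerosInSector α p ∧ ReflectionProperty p ∧
          ¬ TotallyNonneg (hurwitzMatrix n p))) ∧
    (∀ n : ℕ, 1 ≤ n → n ≤ 3 → ∀ p : ℝ[X], IsAdmissible n p →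
      (IsQuasiStable p ↔ TotallyNonneg (hurwitzMatrix n p))) := by
  refine ⟨fun n hn => ⟨fun p hp hs href => totallyNonneg_of_noZerosInSector hn hp hs href,
    fun α hα => exists_not_totallyNonneg hn hα⟩, fun n h1 h3 p hp =>
    ⟨fun h => h.totallyNonneg hp, fun h => isQuasiStable_of_totallyNonneg h1 h3 hp h⟩⟩
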